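/- **Setting.** Let $1\le r<C$. In the $(C,r,M,N)$ combinatorial multi-access coded caching network, a server holds $N$ independent files $W_1,\dots,W_N$, each uniformly distributed on the words of $f$ symbols of a finite field $\mathbb{F}_q$. There are $C$ caches and $\binom{C}{r}$ users: for every $r$-subset $\mathcal{U}$ of $[C]=\{1,\dots,C\}$ there is one user, who accesses the caches $c\in\mathcal{U}$. In the placement phase, before the demands are known, the server stores in each cache $c$ a function $Z_c$ of the files, of at most $Mf$ symbols ($0\le M\le N$). In the delivery phase each user $\mathcal{U}$ requests a file $W_{d_{\mathcal{U}}}$, and for the demand vector $\mathbf{d}=(d_{\mathcal{U}})$ the server broadcasts a function $X$ of the files. The rate $R$ is *achievable at cache memory $M$* over $\mathbb{F}_q$ if there is a positive integer $f_0$ such that for every positive multiple $f$ of $f_0$ there is such a scheme in which, for every demand vector, $X$ has at most $Rf$ symbols and $H(W_{d_{\mathcal{U}}}\mid (Z_c)_{c\in\mathcal{U}},X)=0$ for every user $\mathcal{U}$. **Theorem.** Let $1\le r<C$ and $t\in\{1,\dots,C-r+1\}$, and put $$M_t=\begin{cases}N\left(\dfrac{t}{C}-\dfrac{1}{\binom{C}{t}}\displaystyle\sum_{i=1}^{r-1}\frac{r-i}{r}\binom{r}{i-1}\binom{C-r}{t-r+i-1}\right)&\text{if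 }t\ge r,\\[3mm] N\left(\dfrac{t}{C}-\dfrac{1}{\binom{C}{t}}\displaystyle\sum_{i=1}^{t-1}\frac{t-i}{r}\binom{r}{t-i+1}\binom{C-r}{i-1}\right)&\text{if }t<r,\end{cases}$$ where $\binom{n}{m}=0$ if $n<m$. Then $0\le M_t\le N$, and over every finite field $\mathbb{F}_q$ the rate $\binom{C}{t+r}\big/\binom{C}{t}$ is achievable at cache memory $M_t$. For $t=C-r+1$ one has $M_t=N/r$, and this rate is $0$. -/

import Mathlib

/-- A library of `N` files, each consisting of `f` symbols of the alphabet `F`. -/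
abbrev Library (F : Type*) (N f : ℕ) : Type _ := Fin N → Fin f → F

/-- The users of the combinatorial multi-access network with `C` caches: a user is identified with
the set of the `r` caches that it accesses, and every `r`-subset of the caches is a user. -/
abbrev User (C r : ℕ) : Type := {U : Finset (Fin C) // U.card = r}

/-- A demand vector: user `U` requests the file with index `d U`. -/
abbrev Demand (C r N : ℕ) : Type := User C r → Fin N

/-- The conditional Shannon entropy `H(A | B)` (in nats) of random variables with finitely many
values: `∑ b, P(B = b) ∑ a, -P(A = a | B = b) log P(A = a | B = b)`.  The values `b` with
`P(B = b) = 0` contribute `0`. -/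
noncomputable def condEntropy {Ω α β : Type*} [Fintype α] [Fintype β]
    (P : PMF Ω) (A : Ω → α) (B : Ω → β) : ℝ :=
  ∑ b : β, (P.map B b).toReal *
    ∑ a : α, Real.negMulLog ((P.map (fun ω => (A ω, B ω)) (a, b)).toReal / (P.map B b).toReal)

/-- The placement and the delivery of a caching scheme for `C` caches, `r` caches per user, and
`N` files of `f` symbols.  The placement does not depend on the demands; both phases may encode
the files arbitrarily. -/
structure MACCScheme (F : Type*) (C r N f : ℕ) where
  /-- The number of symbols stored in each cache. -/
  cacheLen : ℕ
  /-- The contents `Z_c` of cache `c`. -/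
  place : Fin C → Library F N f → (Fin cacheLen → F)
  /-- The number of symbols sent when the demand vector is `d`. -/
  txLen : Demand C r N → ℕ
  /-- The transmission `X` for the demand vector `d`. -/
  transmit : (d : Demand C r N) → Library F N f → (Fin (txLen d) → F)

namespace MACCScheme

variable {F : Type*} {C r N f : ℕ}

/-- What user `U` observes: the contents of the caches that it accesses, and the transmission. -/
def observe (S : MACCScheme F C r N f) (d : Demand C r N) (U : User C r) (W : Library F N f) :
    ({c : Fin C // c ∈ U.1} → (Fin S.cacheLen → F)) × (Fin (S.txLen d) → F) :=
  (fun c => S.place c.1 W, S.transmit d W)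

/-- Decodability: for every demand vector `d` and every user `U`, `H(W_{d_U} | Z_U, X) = 0`, where
the files are independent and uniformly distributed on the words of `f` symbols. -/
def Decodable [Fintype F] [Nonempty F] (S : MACCScheme F C r N f) : Prop :=
  ∀ (d : Demand C r N) (U : User C r),
    condEntropy (PMF.uniformOfFintype (Library F N f)) (fun W => W (d U)) (S.observe d U) = 0

end MACCScheme

/-- The rate `R` is achievable with files of `f` symbols from `F` and caches of capacity `M` files:
some decodable scheme stores at most `M` files, that is `M * f` symbols, in each cache, and
transmits at most `R` files, that is `R * f` symbols, for every demand vector. -/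
def AchievableWithFileSize (F : Type*) [Fintype F] [Nonempty F] (C r N f : ℕ) (M R : ℝ) : Prop :=
  ∃ S : MACCScheme F C r N f,
    (S.cacheLen : ℝ) ≤ M * f ∧ (∀ d : Demand C r N, (S.txLen d : ℝ) ≤ R * f) ∧ S.Decodable

/-- The rate `R` is achievable at cache memory `M` (both measured in files) over the alphabet `F`,
for all file sizes that are multiples of some subpacketization number. -/
def Achievable (F : Type*) [Fintype F] [Nonempty F] (C r N : ℕ) (M R : ℝ) : Prop :=
  ∃ f₀ : ℕ, 0 < f₀ ∧ ∀ f : ℕ, 0 < f → f₀ ∣ f → AchievableWithFileSize F C r N f M R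

/-- The cache memory, in files, at which the scheme with parameter `t` operates. -/
noncomputable def schemeMemory (C r N t : ℕ) : ℝ :=
  if r ≤ t then
    (N : ℝ) * ((t : ℝ) / C - 1 / (C.choose t : ℝ) *
      ∑ i ∈ Finset.Icc 1 (r - 1),
        (((r : ℝ) - i) / r) * (r.choose (i - 1) : ℝ) * ((C - r).choose (t - r + i - 1) : ℝ))
  else
    (N : ℝ) * ((t : ℝ) / C - 1 / (C.choose t : ℝ) *
      ∑ i ∈ Finset.Icc 1 (t - 1),
        (((t : ℝ) - i) / r) * (r.choose (t - i + 1) : ℝ) * ((C - r).choose (i - 1) : ℝ))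

/-- The rate, in files, of the scheme with parameter `t`. -/
noncomputable def schemeRate (C r t : ℕ) : ℝ :=
  (C.choose (t + r) : ℝ) / (C.choose t : ℝ)

/-! Split each file into subfiles indexed by pairs (T, a), with T a t-subset of the caches and a one
of r! copy numbers. Cache c stores (r-1)! · `meetCount` linear combinations, per file, of the
subfiles with c ∈ T. The r caches of a user U then give exactly as many equations as there are
subfiles with T meeting U. For generic coefficients this square system is invertible once its
support pattern contains a perfect matching (`exists_matching`); one choice over a finite extension
K of the field serves all users (`exists_generic_matrix`), and each symbol of K is written as [K :
F] symbols of F.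

Delivery sends, for every (t+r)-subset S and every copy, the sum over users V ⊆ S of the subfile of
V's file indexed by S \ V. For U ⊆ S every other term has S \ V meeting U, so U knows it and cancels
it (`eq_of_sums_eq`).

The memory used is N · `meetCount` / (r · binom(C, t)); Vandermonde identities show that this is M_t
(`schemeMemory_eq`). -/

/-! ### Zero conditional entropy from determinism -/

theorem condEntropy_eq_zero_of_determines {Ω α β : Type*} [Fintype α] [Fintype β]
    (P : PMF Ω) (A : Ω → α) (B : Ω → β) (h : ∀ ω ω', B ω = B ω' → A ω = A ω') :
    condEntropy P A B = 0 := by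
  classical
  unfold condEntropy
  refine Finset.sum_eq_zero fun b _ => ?_
  rw [mul_eq_zero]
  right
  refine Finset.sum_eq_zero fun a _ => ?_
  -- Each conditional probability is therefore 0 or 1, where `Real.negMulLog` vanishes; if P(B = b)
  -- = 0, division by zero gives 0 as well.
  have key : P.map (fun ω => (A ω, B ω)) (a, b) = 0 ∨
      P.map (fun ω => (A ω, B ω)) (a, b) = P.map B b := by
    by_cases hab : ∃ ω, A ω = a ∧ B ω = b
    · right
      obtain ⟨ω, rfl, rfl⟩ := hab
      rw [PMF.map_apply, PMF.map_apply]
      refine tsum_congr fun ω' => ?_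
      have : ((A ω, B ω) = (A ω', B ω')) ↔ (B ω = B ω') :=
        ⟨fun e => (Prod.ext_iff.1 e).2, fun e => Prod.ext (h _ _ e) e⟩
      simp only [this]
    · left
      rw [PMF.map_apply, ENNReal.tsum_eq_zero]
      intro ω
      rw [if_neg]
      intro e
      exact hab ⟨ω, (Prod.ext_iff.1 e).1.symm, (Prod.ext_iff.1 e).2.symm⟩
  rcases key with h0 | h1
  · simp [h0]
  · rw [h1]
    by_cases hz : (P.map B b).toReal = 0
    · rw [hz, div_zero, Real.negMulLog_zero]
    · rw [div_self hz, Real.negMulLog_one]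

/-! ### The memory formula -/

/-- The number of `t`-subsets of the caches that meet a given set of `r` caches. -/
def meetCount (C r t : ℕ) : ℕ := C.choose t - (C - r).choose t

theorem cast_meetCount (C r t : ℕ) :
    (meetCount C r t : ℝ) = (C.choose t : ℝ) - ((C - r).choose t : ℝ) := by
  unfold meetCount
  rw [Nat.cast_sub (Nat.choose_le_choose t (Nat.sub_le C r))]

theorem sum_choose_mul_choose (r n t : ℕ) :
    ∑ j ∈ Finset.range (t + 1), (r.choose j : ℝ) * (n.choose (t - j) : ℝ)
      = ((r + n).choose t : ℝ) := by
  rw [Nat.add_choose_eq, Finset.Nat.sum_antidiagonal_eq_sum_range_succ_mk]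
  push_cast
  rfl

/-- Absorption, j · binom(r+1, j) = (r+1) · binom(r, j-1), reduces this to Vandermonde's identity.
-/
theorem sum_mul_choose_mul_choose (r n t : ℕ) :
    ∑ j ∈ Finset.range (t + 2), (j : ℝ) * (((r + 1).choose j : ℝ) * (n.choose (t + 1 - j) : ℝ))
      = (r + 1) * ((r + n).choose t : ℝ) := by
  rw [Finset.sum_range_succ', ← sum_choose_mul_choose r n t, Finset.mul_sum]
  simp only [Nat.cast_zero, zero_mul, add_zero]
  refine Finset.sum_congr rfl fun j _ => ?_
  have h : ((r + 1 : ℕ) : ℝ) * (r.choose j : ℝ) = ((r + 1).choose (j + 1) : ℝ) * ((j + 1 : ℕ) : ℝ) := by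
    exact_mod_cast Nat.add_one_mul_choose_eq r j
  rw [Nat.add_sub_add_right, ← mul_assoc, mul_comm ((j + 1 : ℕ) : ℝ), ← h]
  push_cast
  ring

/-- The difference of the weighted and the plain Vandermonde sums, where j is the size of the
intersection of a t-subset with a fixed r-set. -/
theorem sum_pred_mul_choose_mul_choose {C r t : ℕ} (hr : 1 ≤ r) (hrC : r < C) (ht : 1 ≤ t) :
    ∑ j ∈ Finset.Icc 2 (min r t), ((j : ℝ) - 1) * ((r.choose j : ℝ) * ((C - r).choose (t - j) : ℝ))
      = r * ((C - 1).choose (t - 1) : ℝ) - meetCount C r t := by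
  obtain ⟨r, rfl⟩ := Nat.exists_eq_add_of_le' hr
  obtain ⟨t, rfl⟩ := Nat.exists_eq_add_of_le' ht
  obtain ⟨n, rfl⟩ := Nat.exists_eq_add_of_lt hrC
  have e1 : r + 1 + n + 1 - (r + 1) = n + 1 := by omega
  have e2 : r + 1 + n + 1 - 1 = r + (n + 1) := by omega
  have e3 : r + 1 + n + 1 = (r + 1) + (n + 1) := by omega
  rw [cast_meetCount, e1, e2, e3, ← sum_choose_mul_choose (r + 1) (n + 1) (t + 1)]
  have h := sum_mul_choose_mul_choose r (n + 1) t
  rw [Nat.add_sub_cancel]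
  push_cast
  rw [← h]
  rw [show ∀ a b c : ℝ, a - (b - c) = (a - b) + c by intros; ring, ← Finset.sum_sub_distrib]
  -- The j = 0 term is -binom(C-r, t), which cancels the last summand.
  rw [Finset.sum_range_succ']
  simp only [Nat.choose_zero_right, Nat.cast_zero, Nat.cast_one, zero_mul, one_mul, Nat.sub_zero,
    zero_sub, neg_add_cancel_right]
  symm
  -- The remaining terms outside the target range vanish: intersection size 1 has weight 0, and
  -- sizes above r have a zero binomial.
  refine Finset.sum_bij_ne_zero (fun j _ _ => j + 1) ?_ ?_ ?_ ?_
  · intro j hj hne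
    have h0 : j ≠ 0 := by rintro rfl; simp at hne
    have h1 : j + 1 ≤ r + 1 := by
      by_contra hlt
      rw [Nat.choose_eq_zero_of_lt (not_le.1 hlt)] at hne
      simp at hne
    simp only [Finset.mem_range, Finset.mem_Icc, le_min_iff] at hj ⊢
    omega
  · intro a _ _ b _ _ hab
    omega
  · intro j hj hne
    simp only [Finset.mem_Icc, le_min_iff] at hj
    refine ⟨j - 1, ?_, ?_, ?_⟩
    · simp only [Finset.mem_range]; omega
    · rw [Nat.sub_add_cancel (by omega : 1 ≤ j)]
      rw [← sub_one_mul]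
      exact hne
    · omega
  · intro j _ _
    ring

/-- Both cases of the definition are the same sum over intersection sizes j ≥ 2, indexed backwards
from min r t: j = r - i + 1 if r ≤ t, and j = t - i + 1 otherwise. -/
theorem schemeMemory_eq {C r t : ℕ} (N : ℕ) (hr : 1 ≤ r) (hrC : r < C) (ht : 1 ≤ t) (htC : t ≤ C) :
    schemeMemory C r N t = N * meetCount C r t / (r * C.choose t) := by
  have hb : (C.choose t : ℝ) ≠ 0 := by exact_mod_cast (Nat.choose_pos htC).ne'
  have hr0 : (r : ℝ) ≠ 0 := by exact_mod_cast (by omega : r ≠ 0)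
  have hC0 : (C : ℝ) ≠ 0 := by exact_mod_cast (by omega : C ≠ 0)
  have hS := sum_pred_mul_choose_mul_choose hr hrC ht
  have hc : (C : ℝ) * ((C - 1).choose (t - 1) : ℝ) = (C.choose t : ℝ) * t := by
    have := Nat.add_one_mul_choose_eq (C - 1) (t - 1)
    rw [Nat.sub_add_cancel (by omega : 1 ≤ C), Nat.sub_add_cancel ht] at this
    exact_mod_cast this
  have htc : (t : ℝ) / C = ((C - 1).choose (t - 1) : ℝ) / (C.choose t : ℝ) := by
    rw [div_eq_div_iff hC0 hb]; linarith
  have fin : ∀ x : ℝ, x = 1 / r * (r * ((C - 1).choose (t - 1) : ℝ) - meetCount C r t) →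
      (N : ℝ) * ((t : ℝ) / C - 1 / (C.choose t : ℝ) * x)
        = N * meetCount C r t / (r * C.choose t) := by
    rintro x rfl
    rw [htc]
    field_simp
    ring
  unfold schemeMemory
  split_ifs with h
  · refine fin _ ?_
    rw [← hS, Finset.mul_sum, min_eq_left h]
    refine Finset.sum_nbij' (fun i => r - i + 1) (fun j => r - j + 1) ?_ ?_ ?_ ?_ ?_
    · intro i hi; simp only [Finset.mem_Icc] at hi ⊢; omega
    · intro i hi; simp only [Finset.mem_Icc] at hi ⊢; omega
    · intro i hi; simp only [Finset.mem_Icc] at hi ⊢; omega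
    · intro i hi; simp only [Finset.mem_Icc] at hi ⊢; omega
    · intro i hi
      simp only [Finset.mem_Icc] at hi
      have e : t - (r - i + 1) = t - r + i - 1 := by omega
      rw [e, ← Nat.choose_symm (show i - 1 ≤ r by omega),
        show r - (i - 1) = r - i + 1 by omega]
      push_cast [Nat.cast_sub (show i ≤ r by omega)]
      ring
  · refine fin _ ?_
    rw [← hS, Finset.mul_sum, min_eq_right (by omega : t ≤ r)]
    refine Finset.sum_nbij' (fun i => t - i + 1) (fun j => t - j + 1) ?_ ?_ ?_ ?_ ?_
    · intro i hi; simp only [Finset.mem_Icc] at hi ⊢; omega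
    · intro i hi; simp only [Finset.mem_Icc] at hi ⊢; omega
    · intro i hi; simp only [Finset.mem_Icc] at hi ⊢; omega
    · intro i hi; simp only [Finset.mem_Icc] at hi ⊢; omega
    · intro i hi
      simp only [Finset.mem_Icc] at hi
      have e : t - (t - i + 1) = i - 1 := by omega
      rw [e]
      push_cast [Nat.cast_sub (show i ≤ t by omega)]
      ring

/-! ### Matching subfiles with cached symbols -/

theorem exists_balanced_map {α : Type*} [DecidableEq α] (A : Finset α) {m : ℕ}
    (hm : A.card ∣ m) :
    ∃ φ : Fin m → α, (∀ a, φ a ∈ A) ∧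
      ∀ c ∈ A, (Finset.univ.filter fun a => φ a = c).card = m / A.card := by
  have hcard : Fintype.card (Fin m) = Fintype.card (A × Fin (m / A.card)) := by
    simp [Nat.mul_div_cancel' hm]
  let e := Fintype.equivOfCardEq hcard
  refine ⟨fun a => (e a).1, fun a => (e a).1.2, fun c hc => ?_⟩
  refine Eq.trans ?_ (Finset.card_fin (m / A.card))
  refine Finset.card_nbij' (fun a => (e a).2) (fun b => e.symm (⟨c, hc⟩, b)) ?_ ?_ ?_ ?_
  · intro a _; simp
  · intro b _; simp
  · intro a ha
    have : (e a).1.1 = c := by simpa using ha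
    have h2 : ((⟨c, hc⟩ : A), (e a).2) = e a := Prod.ext (Subtype.ext this.symm) rfl
    simp [h2]
  · intro b _; simp

/-- The `t`-subsets of the caches. -/
abbrev CacheSubset (C t : ℕ) : Type := {T : Finset (Fin C) // T.card = t}

theorem card_cacheSubset (C t : ℕ) : Fintype.card (CacheSubset C t) = C.choose t := by
  rw [Fintype.card_finset_len, Fintype.card_fin]

theorem card_not_disjoint {C r t : ℕ} (U : Finset (Fin C)) (hU : U.card = r) :
    (Finset.univ.filter fun T : CacheSubset C t => ¬ Disjoint T.1 U).card = meetCount C r t := by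
  have h1 : (Finset.univ.filter fun T : CacheSubset C t => Disjoint T.1 U).card
      = (C - r).choose t := by
    have : (Finset.powersetCard t Uᶜ).card = (C - r).choose t := by
      rw [Finset.card_powersetCard, Finset.card_compl, Fintype.card_fin, hU]
    rw [← this]
    refine Finset.card_bij (fun T _ => T.1) ?_ ?_ ?_
    · intro T hT
      rw [Finset.mem_powersetCard]
      exact ⟨Finset.subset_compl_iff_disjoint_right.2 (by simpa using hT), T.2⟩
    · intro a _ b _ h
      exact Subtype.ext h
    · intro T hT
      rw [Finset.mem_powersetCard] at hT
      exact ⟨⟨T, hT.2⟩, by simpa using Finset.subset_compl_iff_disjoint_right.1 hT.1, rfl⟩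
  have h2 := Finset.card_filter_add_card_filter_not (s := (Finset.univ : Finset (CacheSubset C t)))
    (fun T => Disjoint T.1 U)
  rw [Finset.card_univ, card_cacheSubset, h1] at h2
  unfold meetCount
  omega

/-- The transposition of c and c' permutes the t-subsets while preserving U, hence the sizes of
intersections with U. -/
theorem sum_mem_eq_sum_mem {C t : ℕ} (U : Finset (Fin C)) (w : ℕ → ℕ) {c c' : Fin C} (hc : c ∈ U)
    (hc' : c' ∈ U) :
    (∑ T : CacheSubset C t, if c ∈ T.1 then w (T.1 ∩ U).card else 0)
      = ∑ T : CacheSubset C t, if c' ∈ T.1 then w (T.1 ∩ U).card else 0 := by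
  let s := Equiv.swap c c'
  have hU : U.map s.toEmbedding = U := by
    refine Finset.eq_of_subset_of_card_le ?_ (by simp)
    intro x hx
    obtain ⟨y, hy, rfl⟩ := Finset.mem_map.1 hx
    change Equiv.swap c c' y ∈ U
    rw [Equiv.swap_apply_def]
    split_ifs <;> assumption
  refine Fintype.sum_equiv
    (s.finsetCongr.subtypeEquiv (fun T => by simp [Equiv.finsetCongr_apply])) _ _ fun T => ?_
  have h1 : c' ∈ T.1.map s.toEmbedding ↔ c ∈ T.1 := by
    rw [Finset.mem_map_equiv]
    simp [s]
  have h2 : (T.1.map s.toEmbedding ∩ U).card = (T.1 ∩ U).card := by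
    conv_lhs => rw [← hU, ← Finset.map_inter, Finset.card_map]
  simp only [Equiv.subtypeEquiv_apply, Equiv.finsetCongr_apply, h1, h2]

/-- The pairs of a `t`-subset of the caches and a copy number can be matched to the caches of `U`
that they contain, with equally many pairs for each cache of `U`. -/
theorem exists_matching {C r t : ℕ} (hr : 1 ≤ r) (U : Finset (Fin C)) (hU : U.card = r) :
    ∃ e : {τ : CacheSubset C t × Fin r.factorial // ¬ Disjoint τ.1.1 U} ≃
        {c // c ∈ U} × Fin (meetCount C r t * (r - 1).factorial),
      ∀ τ, ((e τ).1 : Fin C) ∈ τ.1.1.1 := by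
  classical
  have hφ : ∀ T : CacheSubset C t, ∃ φ : Fin r.factorial → Fin C, ¬ Disjoint T.1 U →
      (∀ a, φ a ∈ T.1 ∩ U) ∧ ∀ c ∈ T.1 ∩ U,
        (Finset.univ.filter fun a => φ a = c).card = r.factorial / (T.1 ∩ U).card := by
    intro T
    by_cases hT : Disjoint T.1 U
    · have : Nonempty (Fin C) := by
        obtain ⟨c, _⟩ : U.Nonempty := Finset.card_pos.1 (by omega)
        exact ⟨c⟩
      exact ⟨fun _ => this.some, fun h => absurd hT h⟩
    · have hne : (T.1 ∩ U).Nonempty := Finset.not_disjoint_iff_nonempty_inter.1 hT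
      -- The r! copies make an even split possible for every intersection size, as 1 ≤ |T ∩ U| ≤ r.
      obtain ⟨φ, h⟩ := exists_balanced_map (T.1 ∩ U) (m := r.factorial)
        (Nat.dvd_factorial hne.card_pos (hU ▸ Finset.card_le_card Finset.inter_subset_right))
      exact ⟨φ, fun _ => h⟩
  choose φ hφ using hφ
  let τs := {τ : CacheSubset C t × Fin r.factorial // ¬ Disjoint τ.1.1 U}
  let f : τs → {c // c ∈ U} := fun τ =>
    ⟨φ τ.1.1 τ.1.2, Finset.mem_of_mem_inter_right ((hφ τ.1.1 τ.2).1 τ.1.2)⟩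
  let n : Fin C → ℕ := fun c =>
    ∑ T : CacheSubset C t, if c ∈ T.1 then r.factorial / (T.1 ∩ U).card else 0
  have hfib : ∀ c : {c // c ∈ U}, Fintype.card {τ : τs // f τ = c} = n c.1 := by
    intro c
    have e1 : Fintype.card {τ : τs // f τ = c}
        = Fintype.card {τ : CacheSubset C t × Fin r.factorial //
            ¬ Disjoint τ.1.1 U ∧ φ τ.1 τ.2 = c.1} := by
      refine Fintype.card_congr ⟨fun τ => ⟨τ.1.1, τ.1.2, congrArg Subtype.val τ.2⟩,
        fun τ => ⟨⟨τ.1, τ.2.1⟩, Subtype.ext τ.2.2⟩, fun _ => rfl, fun _ => rfl⟩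
    rw [e1, Fintype.card_subtype, Finset.card_filter, Fintype.sum_prod_type]
    refine Finset.sum_congr rfl fun T _ => ?_
    rw [← Finset.card_filter]
    split_ifs with hc
    · have hd : ¬ Disjoint T.1 U := Finset.not_disjoint_iff.2 ⟨c.1, hc, c.2⟩
      simp only [hd, not_false_eq_true, true_and]
      exact (hφ T hd).2 c.1 (Finset.mem_inter.2 ⟨hc, c.2⟩)
    · rw [Finset.card_eq_zero, Finset.filter_eq_empty_iff]
      rintro a _ ⟨hd, h⟩
      exact hc (h ▸ Finset.mem_of_mem_inter_left ((hφ T hd).1 a))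
  have htot : Fintype.card τs = meetCount C r t * r.factorial := by
    have e1 : Fintype.card τs = Fintype.card ({T : CacheSubset C t // ¬ Disjoint T.1 U} ×
        Fin r.factorial) :=
      Fintype.card_congr ⟨fun τ => (⟨τ.1.1, τ.2⟩, τ.1.2), fun p => ⟨(p.1.1, p.2), p.1.2⟩,
        fun _ => rfl, fun _ => rfl⟩
    rw [e1, Fintype.card_prod, Fintype.card_fin, Fintype.card_subtype, card_not_disjoint U hU]
  have hsum : ∑ c : {c // c ∈ U}, n c.1 = meetCount C r t * r.factorial := by
    rw [← htot, ← Fintype.card_congr (Equiv.sigmaFiberEquiv f), Fintype.card_sigma]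
    exact Finset.sum_congr rfl fun c _ => (hfib c).symm
  -- By symmetry all r caches of U receive equally many pairs, so each gets a 1/r share of the
  -- total.
  have hn : ∀ c : {c // c ∈ U}, n c.1 = meetCount C r t * (r - 1).factorial := by
    intro c
    have h : ∑ c' : {c // c ∈ U}, n c'.1 = r * n c.1 := by
      rw [Finset.sum_congr rfl fun c' _ =>
        sum_mem_eq_sum_mem U (fun k => r.factorial / k) c'.2 c.2,
        Finset.sum_const, Finset.card_univ, Fintype.card_coe, hU, smul_eq_mul]
    have : r * n c.1 = r * (meetCount C r t * (r - 1).factorial) := by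
      rw [← h, hsum, ← Nat.mul_factorial_pred (by omega : r ≠ 0), mul_left_comm]
    exact Nat.eq_of_mul_eq_mul_left (by omega) this
  have hg : ∀ c : {c // c ∈ U}, Fintype.card {p : {c // c ∈ U} ×
      Fin (meetCount C r t * (r - 1).factorial) // p.1 = c}
        = meetCount C r t * (r - 1).factorial := by
    intro c
    conv_rhs => rw [← Fintype.card_fin (meetCount C r t * (r - 1).factorial)]
    exact Fintype.card_congr ⟨fun p => p.1.2, fun b => ⟨(c, b), rfl⟩,
      fun p => Subtype.ext (Prod.ext p.2.symm rfl), fun _ => rfl⟩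
  let E := Equiv.ofFiberEquiv (f := f)
    (g := (Prod.fst : {c // c ∈ U} × Fin (meetCount C r t * (r - 1).factorial) → _))
    fun c => Fintype.equivOfCardEq (by rw [hfib, hn, hg])
  refine ⟨E, fun τ => ?_⟩
  have : (E τ).1 = f τ := Equiv.ofFiberEquiv_map _ τ
  rw [this]
  exact Finset.mem_of_mem_inter_left ((hφ τ.1.1 τ.2).1 τ.1.2)

/-! ### Generic linear placement -/

/-- If rows and columns admit perfect matchings within a support pattern, then a matrix with this
pattern over a suitable finite extension makes all the corresponding submatrices invertible. -/
theorem exists_generic_matrix.{u} (F : Type u) [Field F] [Finite F] {ρ σ ι : Type}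
    [Fintype σ] [DecidableEq ρ] [Finite ρ] [Finite ι] [DecidableEq σ]
    (supp : ρ → σ → Prop) (rows : ι → Set ρ) (cols : ι → Set σ)
    (hsupp : ∀ i, ∀ p ∈ rows i, ∀ q, supp p q → q ∈ cols i)
    (e : ∀ i, cols i ≃ rows i) (he : ∀ i q, supp (e i q).1 q.1) :
    ∃ (K : Type u) (_ : Field K) (_ : Algebra F K) (_ : FiniteDimensional F K) (x : ρ → σ → K),
      ∀ i, ∀ v : σ → K, (∀ p ∈ rows i, ∑ q, x p q * v q = 0) → ∀ q ∈ cols i, v q = 0 := by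
  classical
  cases nonempty_fintype ι
  let L := AlgebraicClosure F
  let M : ∀ i, Matrix (cols i) (cols i) (MvPolynomial (ρ × σ) L) := fun i => Matrix.of fun q q' =>
    if supp (e i q).1 q'.1 then MvPolynomial.X ((e i q).1, q'.1) else 0
  have hev : ∀ (z : ρ × σ → L) i, MvPolynomial.eval z (M i).det
      = (Matrix.of fun q q' : cols i =>
          if supp (e i q).1 q'.1 then z ((e i q).1, q'.1) else 0).det := by
    intro z i
    rw [RingHom.map_det]
    congr 1
    ext q q'
    simp only [M, RingHom.mapMatrix_apply, Matrix.map_apply, Matrix.of_apply]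
    split_ifs <;> simp
  have hdet : ∀ i, (M i).det ≠ 0 := by
    intro i h0
    -- The indicator of the matching turns the matrix, with rows ordered by `e i`, into the
    -- identity, so its determinant polynomial is nonzero.
    let z : ρ × σ → L := fun pq => if ∃ h : pq.2 ∈ cols i, (e i ⟨pq.2, h⟩).1 = pq.1 then 1 else 0
    have h1 := hev z i
    rw [h0, map_zero] at h1
    have h2 : (Matrix.of fun q q' : cols i =>
        if supp (e i q).1 q'.1 then z ((e i q).1, q'.1) else 0) = 1 := by
      ext q q'
      simp only [Matrix.of_apply, z, Matrix.one_apply]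
      by_cases hq : q = q'
      · subst hq
        rw [if_pos (he i q), if_pos ⟨q.2, rfl⟩, if_pos rfl]
      · rw [if_neg hq, if_neg (c := ∃ _, _), ite_self]
        rintro ⟨h, h'⟩
        exact hq ((e i).injective (Subtype.ext h'.symm))
    rw [h2, Matrix.det_one] at h1
    exact zero_ne_one h1
  -- A polynomial vanishing everywhere on an infinite field is zero; here the field is the algebraic
  -- closure, and the product handles all indices at once.
  obtain ⟨z, hz⟩ : ∃ z : ρ × σ → L, MvPolynomial.eval z (∏ i, (M i).det) ≠ 0 := by
    by_contra! h
    exact Finset.prod_ne_zero_iff.2 (fun i _ => hdet i)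
      (MvPolynomial.funext fun z => by rw [h z, map_zero])
  rw [map_prod, Finset.prod_ne_zero_iff] at hz
  let y : ρ → σ → L := fun p q => if supp p q then z (p, q) else 0
  let S : Set L := Set.range fun pq : ρ × σ => y pq.1 pq.2
  -- Finitely many algebraic entries generate a finite extension.
  let K := IntermediateField.adjoin F S
  have hK : FiniteDimensional F K :=
    IntermediateField.finiteDimensional_adjoin fun x _ => Algebra.IsIntegral.isIntegral x
  refine ⟨K, inferInstance, inferInstance, hK,
    fun p q => ⟨y p q, IntermediateField.subset_adjoin F S ⟨(p, q), rfl⟩⟩, fun i v hv q hq => ?_⟩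
  have hd := hz i (Finset.mem_univ i)
  rw [hev] at hd
  have := Matrix.eq_zero_of_mulVec_eq_zero hd (v := fun q : cols i => (v q.1 : L)) (by
    ext q'
    have h := congrArg (fun k : K => (k : L)) (hv (e i q').1 (e i q').2)
    simp only [AddSubmonoidClass.coe_finsetSum, MulMemClass.coe_mul, ZeroMemClass.coe_zero] at h
    refine Eq.trans ?_ h
    simp only [Matrix.mulVec, dotProduct, Matrix.of_apply]
    refine Fintype.sum_of_injective Subtype.val Subtype.val_injective _ _ (fun q hq => ?_)
      fun q => rfl
    -- The support condition kills the columns outside `cols i`, so the full sum is the product with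
    -- the square submatrix.
    have hn : ¬ supp (e i q').1 q := fun hs =>
      hq ⟨⟨q, hsupp i _ (e i q').2 q hs⟩, rfl⟩
    simp only [y, if_neg hn, zero_mul])
  exact Subtype.ext (congrFun this ⟨q, hq⟩)

/-- Linear placement functionals for the subfiles of one file: the caches of every user determine
exactly the subfiles whose index set meets the caches of that user. -/
theorem exists_placement.{u} (F : Type u) [Field F] [Finite F] (C r t : ℕ) (hr : 1 ≤ r) :
    ∃ (K : Type u) (_ : Field K) (_ : Algebra F K) (_ : FiniteDimensional F K)
      (x : Fin C → Fin (meetCount C r t * (r - 1).factorial) →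
        CacheSubset C t × Fin r.factorial → K),
      ∀ U : User C r, ∀ v w : CacheSubset C t × Fin r.factorial → K,
        (∀ c ∈ U.1, ∀ i, ∑ q, x c i q * v q = ∑ q, x c i q * w q) →
          ∀ q, ¬ Disjoint q.1.1 U.1 → v q = w q := by
  classical
  choose e he using fun U : User C r => exists_matching (t := t) hr U.1 U.2
  let s := meetCount C r t * (r - 1).factorial
  let rows : User C r → Set (Fin C × Fin s) := fun U => {p | p.1 ∈ U.1}
  let cols : User C r → Set (CacheSubset C t × Fin r.factorial) :=
    fun U => {q | ¬ Disjoint q.1.1 U.1}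
  let toRows : ∀ U : User C r, {c // c ∈ U.1} × Fin s ≃ rows U := fun U =>
    ⟨fun p => ⟨(p.1.1, p.2), p.1.2⟩, fun p => (⟨p.1.1, p.2⟩, p.1.2), fun _ => rfl, fun _ => rfl⟩
  obtain ⟨K, i1, i2, i3, x, hx⟩ := exists_generic_matrix F
    (fun (p : Fin C × Fin s) (q : CacheSubset C t × Fin r.factorial) => p.1 ∈ q.1.1) rows cols
    (fun U p hp q hq => Finset.not_disjoint_iff.2 ⟨p.1, hq, hp⟩)
    (fun U => (e U).trans (toRows U)) he
  refine ⟨K, i1, i2, i3, fun c i q => x (c, i) q, fun U v w h q hq => ?_⟩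
  refine sub_eq_zero.1 (hx U (fun q => v q - w q) (fun p hp => ?_) q hq)
  simp only [mul_sub, Finset.sum_sub_distrib]
  exact sub_eq_zero.2 (h p.1 hp p.2)

/-! ### Delivery and the resulting scheme -/

/-- Words over a finite extension, written as words over the base field. -/
theorem nonempty_equiv_words {F K ι : Type*} [Field F] [Finite F] [Field K] [Algebra F K]
    [FiniteDimensional F K] [Finite ι] {n : ℕ} (hn : n = Nat.card ι * Module.finrank F K) :
    Nonempty ((ι → K) ≃ (Fin n → F)) := by
  have : Finite K := Module.finite_of_finite F
  rw [← Finite.card_eq, Nat.card_fun, Nat.card_fun, Module.natCard_eq_pow_finrank (K := F), hn,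
    Nat.card_fin, ← pow_mul, mul_comm]

/-- A user that knows the subfiles meeting its caches extracts the remaining subfiles of its file
from the sums over the `(t + r)`-subsets. -/
theorem eq_of_sums_eq {C r t : ℕ} {K : Type*} [AddCommGroup K]
    (y y' : User C r → CacheSubset C t → K) (U : User C r)
    (hknown : ∀ V T, ¬ Disjoint T.1 U.1 → y V T = y' V T)
    (hsum : ∀ S : CacheSubset C (t + r),
      (∑ V : User C r, if h : (S.1 \ V.1).card = t then y V ⟨S.1 \ V.1, h⟩ else 0)
        = ∑ V : User C r, if h : (S.1 \ V.1).card = t then y' V ⟨S.1 \ V.1, h⟩ else 0)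
    (T : CacheSubset C t) : y U T = y' U T := by
  classical
  by_cases hT : Disjoint T.1 U.1
  · have hS : (T.1 ∪ U.1).card = t + r := by rw [Finset.card_union_of_disjoint hT, T.2, U.2]
    have h := hsum ⟨T.1 ∪ U.1, hS⟩
    rw [← Finset.add_sum_erase _ _ (Finset.mem_univ U),
      ← Finset.add_sum_erase _ (fun V => dite _ _ _) (Finset.mem_univ U)] at h
    have hU : (T.1 ∪ U.1) \ U.1 = T.1 := Finset.union_sdiff_cancel_right hT
    -- If S \ V is disjoint from U ⊆ S, then U ⊆ V, and equal cardinalities force V = U.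
    have hrest : ∀ V ∈ Finset.univ.erase U, ∀ h : ((T.1 ∪ U.1) \ V.1).card = t,
        y V ⟨(T.1 ∪ U.1) \ V.1, h⟩ = y' V ⟨(T.1 ∪ U.1) \ V.1, h⟩ := by
      intro V hV hc
      refine hknown V _ fun hd => Finset.ne_of_mem_erase hV ?_
      have hsub : U.1 ⊆ V.1 := by
        intro c hc
        by_contra hcV
        exact Finset.disjoint_left.1 hd
          (Finset.mem_sdiff.2 ⟨Finset.mem_union_right _ hc, hcV⟩) hc
      exact Subtype.ext (Finset.eq_of_subset_of_card_le hsub (by rw [U.2, V.2])).symm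
    rw [Finset.sum_congr rfl fun V hV => dite_congr rfl (fun h => hrest V hV h) fun _ => rfl] at h
    have h := add_right_cancel h
    simp only [hU, T.2, dite_true] at h
    exact h
  · exact hknown U T hT

theorem achievable_schemeMemory (C r N t : ℕ) (hr : 1 ≤ r) (hrC : r < C) (ht : 1 ≤ t)
    (htC : t ≤ C) (F : Type*) [Field F] [Fintype F] :
    Achievable F C r N (schemeMemory C r N t) (schemeRate C r t) := by
  classical
  have H := exists_placement F C r t hr
  generalize hs : meetCount C r t * (r - 1).factorial = s at H
  obtain ⟨K, i1, i2, i3, x, hx⟩ := H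
  set k := Module.finrank F K
  have hk : 0 < k := Module.finrank_pos
  have hb : 0 < C.choose t := Nat.choose_pos htC
  have hm : 0 < r.factorial := Nat.factorial_pos r
  -- A file of this many symbols of F times g is a g-tuple of symbols of K for each of the binom(C,
  -- t) · r! subfiles; the g layers are coded independently.
  refine ⟨C.choose t * r.factorial * k, by positivity, ?_⟩
  rintro f - ⟨g, rfl⟩
  obtain ⟨E⟩ := nonempty_equiv_words (F := F) (K := K)
    (ι := (CacheSubset C t × Fin r.factorial) × Fin g) (n := C.choose t * r.factorial * k * g)
    (by rw [Nat.card_eq_fintype_card]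
        simp only [Fintype.card_prod, card_cacheSubset, Fintype.card_fin]
        ring)
  obtain ⟨EZ⟩ := nonempty_equiv_words (F := F) (K := K) (ι := Fin N × Fin s × Fin g)
    (n := N * s * g * k) (by
      rw [Nat.card_eq_fintype_card]
      simp only [Fintype.card_prod, Fintype.card_fin]
      ring)
  obtain ⟨EX⟩ := nonempty_equiv_words (F := F) (K := K)
    (ι := CacheSubset C (t + r) × Fin r.factorial × Fin g)
    (n := C.choose (t + r) * r.factorial * g * k) (by
      rw [Nat.card_eq_fintype_card]
      simp only [Fintype.card_prod, card_cacheSubset, Fintype.card_fin]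
      ring)
  refine ⟨{ cacheLen := N * s * g * k
            place := fun c W => EZ fun p => ∑ q, x c p.2.1 q * E.symm (W p.1) (q, p.2.2)
            txLen := fun _ => C.choose (t + r) * r.factorial * g * k
            transmit := fun d W => EX fun p => ∑ V : User C r,
              -- Since |S| = t + r and |V| = r, this condition says V ⊆ S.
              if h : (p.1.1 \ V.1).card = t then
                E.symm (W (d V)) ((⟨p.1.1 \ V.1, h⟩, p.2.1), p.2.2) else 0 }, ?_, ?_, ?_⟩
  · refine le_of_eq ?_
    have hb' : (C.choose t : ℝ) ≠ 0 := by exact_mod_cast hb.ne'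
    have hr' : (r : ℝ) ≠ 0 := by exact_mod_cast (by omega : r ≠ 0)
    simp only [← hs]
    rw [schemeMemory_eq N hr hrC ht htC, ← Nat.mul_factorial_pred (by omega : r ≠ 0)]
    push_cast
    field_simp
  · intro d
    refine le_of_eq ?_
    have hb' : (C.choose t : ℝ) ≠ 0 := by exact_mod_cast hb.ne'
    unfold schemeRate
    push_cast
    field_simp
  · intro d U
    refine condEntropy_eq_zero_of_determines _ _ _ fun W W' hW => ?_
    obtain ⟨hZ, hX⟩ := Prod.ext_iff.1 hW
    have hZ' : ∀ c ∈ U.1, ∀ n i j, ∑ q, x c i q * E.symm (W n) (q, j)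
        = ∑ q, x c i q * E.symm (W' n) (q, j) := fun c hc n i j =>
      congrFun (EZ.injective (congrFun hZ ⟨c, hc⟩)) (n, i, j)
    have hX' := fun S a j => congrFun (EX.injective hX) (S, a, j)
    refine E.symm.injective (funext fun ⟨⟨T, a⟩, j⟩ => ?_)
    exact eq_of_sums_eq (fun V T => E.symm (W (d V)) ((T, a), j))
      (fun V T => E.symm (W' (d V)) ((T, a), j)) U
      (fun V T hT => hx U (fun q => E.symm (W (d V)) (q, j)) (fun q => E.symm (W' (d V)) (q, j))
        (fun c hc i => hZ' c hc (d V) i j) (T, a) hT)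
      (fun S => hX' S a j) T

theorem theorem1 (C r N t : ℕ) (hr : 1 ≤ r) (hrC : r < C) (ht : 1 ≤ t) (htC : t ≤ C - r + 1) :
    (0 ≤ schemeMemory C r N t ∧ schemeMemory C r N t ≤ N) ∧
    (∀ (F : Type*) [Field F] [Fintype F],
      Achievable F C r N (schemeMemory C r N t) (schemeRate C r t)) ∧
    (t = C - r + 1 → schemeMemory C r N t = (N : ℝ) / r ∧ schemeRate C r t = 0) := by
  have htC' : t ≤ C := by omega
  have hb : (0 : ℝ) < C.choose t := by exact_mod_cast Nat.choose_pos htC'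
  have hr' : (1 : ℝ) ≤ r := by exact_mod_cast hr
  have hM := schemeMemory_eq N hr hrC ht htC'
  refine ⟨⟨?_, ?_⟩, fun F _ _ => achievable_schemeMemory C r N t hr hrC ht htC' F, ?_⟩
  · rw [hM]
    positivity
  · rw [hM, mul_div_assoc]
    refine mul_le_of_le_one_right (Nat.cast_nonneg N) ((div_le_one (by positivity)).2 ?_)
    have hle : (meetCount C r t : ℝ) ≤ C.choose t := by exact_mod_cast Nat.sub_le _ _
    exact hle.trans (le_mul_of_one_le_left hb.le hr')
  · intro h
    constructor
    -- Every t-subset now meets every user's caches, so the placement alone delivers all files.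
    · have h0 : (C - r).choose t = 0 := Nat.choose_eq_zero_of_lt (by omega)
      rw [hM, cast_meetCount, h0, Nat.cast_zero, sub_zero]
      field_simp
    · unfold schemeRate
      rw [Nat.choose_eq_zero_of_lt (by omega : C < t + r), Nat.cast_zero, zero_div]
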